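/- Let $0<H<1$ and let $Z=(Z_t)_{t\ge 0}$ be a fractional Brownian motion with Hurst parameter $H$, i.e. a centered Gaussian process with (almost surely) continuous paths and covariance $\mathbf E(Z_tZ_s)=\tfrac12\left(t^{2H}+s^{2H}-|t-s|^{2H}\right)$. For $\alpha>0$ and $t\in\mathbf R$ put $a_t=a_t(\alpha)=H e^{\alpha t/H}/\alpha$, and let $$Y^{(\alpha)}_t=\int_0^t e^{-\alpha s}\,dZ_{a_s(\alpha)},\qquad t\in\mathbf R,$$ the integral being a pathwise Riemann--Stieltjes integral (with $\int_0^t=-\int_t^0$ for $t<0$). For $\gamma>0$ let $$U^{(D,\gamma)}_t=e^{-\gamma t}\int_{-\infty}^t e^{\gamma s}\,dY^{(1)}_s=e^{-\gamma t}\int_{-\infty}^t e^{(\gamma-1)s}\,dZ_{a_s(1)},\qquad t\in\mathbf R,$$ where $\int_{-\infty}^t=\lim_{T\to-\infty}\int_T^t$, again with pathwise Riemann--Stieltjes integrals. A function is called locally Hölder continuous of order $\beta$ on an interval $J\subseteq\mathbf R$ if it is Hölder continuous of order $\beta$ on every compact interval contained in $J$. Then for all $\alpha,\gamma>0$, almost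 surely: 1. the integrals defining $Y^{(\alpha)}_t$ exist for all $t\in\mathbf R$, and $t\mapsto Y^{(\alpha)}_t$ is locally Hölder continuous on $\mathbf R$ of every order $\beta\in(0,H)$; 2. both improper integrals in the definition of $U^{(D,\gamma)}_t$ exist and coincide for all $t\in\mathbf R$, and $t\mapsto U^{(D,\gamma)}_t$ is locally Hölder continuous on $\mathbf R$ of every order $\beta\in(0,H)$; 3. for every interval $J\subseteq\mathbf R$, every function $u$ that is continuous on $J$ and solves the Langevin equation $du_t=-\gamma u_t\,dt+dY^{(1)}_t$ on $J$, i.e. $u_t-u_s=-\gamma\int_s^t u_r\,dr+Y^{(1)}_t-Y^{(1)}_s$ for all $s,t\in J$, is locally Hölder continuous on $J$ of every order $\beta\in(0,H)$. -/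

import Mathlib

open MeasureTheory ProbabilityTheory Set Filter Topology
open scoped NNReal

/-- `(x, ξ)` is a tagged partition of the oriented interval from `a` to `b` with `n` pieces, all of
length less than `δ`. For `a ≤ b` the points increase, for `b ≤ a` they decrease. -/
structure IsTaggedPartition (a b δ : ℝ) (n : ℕ) (x ξ : ℕ → ℝ) : Prop where
  left : x 0 = a
  right : x n = b
  monotone_or_antitone : (∀ i < n, x i ≤ x (i + 1)) ∨ (∀ i < n, x (i + 1) ≤ x i)
  mesh : ∀ i < n, |x (i + 1) - x i| < δ
  tag : ∀ i < n, ξ i ∈ uIcc (x i) (x (i + 1))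

/-- The Riemann-Stieltjes integral `∫_a^b f dg` exists and equals `I` (limit of Riemann-Stieltjes
sums as the mesh tends to zero). For `b < a` the partitions run from `a` down to `b`, which gives
the usual convention `∫_a^b f dg = -∫_b^a f dg`. -/
def HasRSIntegral (f g : ℝ → ℝ) (a b I : ℝ) : Prop :=
  ∀ ε > 0, ∃ δ > 0, ∀ (n : ℕ) (x ξ : ℕ → ℝ), IsTaggedPartition a b δ n x ξ →
    |(∑ i ∈ Finset.range n, f (ξ i) * (g (x (i + 1)) - g (x i))) - I| < ε

open Classical in
/-- The value of the Riemann-Stieltjes integral `∫_a^b f dg` (`0` if it does not exist). -/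
noncomputable def rsIntegral (f g : ℝ → ℝ) (a b : ℝ) : ℝ :=
  if h : ∃ I, HasRSIntegral f g a b I then h.choose else 0

/-- The improper Riemann-Stieltjes integral `∫_{-∞}^b f dg = lim_{T → -∞} ∫_T^b f dg` exists and
equals `I`. -/
def HasRSIntegralIic (f g : ℝ → ℝ) (b I : ℝ) : Prop :=
  (∀ T ≤ b, ∃ J, HasRSIntegral f g T b J) ∧ Tendsto (fun T => rsIntegral f g T b) atBot (𝓝 I)

open Classical in
/-- The value of the improper integral `∫_{-∞}^b f dg` (`0` if it does not exist). -/
noncomputable def rsIntegralIic (f g : ℝ → ℝ) (b : ℝ) : ℝ :=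
  if h : ∃ I, HasRSIntegralIic f g b I then h.choose else 0

/-- `Z` is a fractional Brownian motion with Hurst parameter `H`: a centered Gaussian process
indexed by `[0, ∞)` with the covariance `(t^{2H} + s^{2H} - |t - s|^{2H}) / 2` and almost surely
continuous paths. -/
structure IsFractionalBrownianMotion {Ω : Type*} [MeasurableSpace Ω] (H : ℝ) (Z : ℝ≥0 → Ω → ℝ)
    (P : Measure Ω) : Prop where
  gaussian : IsGaussianProcess Z P
  centered : ∀ t, ∫ ω, Z t ω ∂P = 0
  covariance : ∀ s t : ℝ≥0, ∫ ω, Z t ω * Z s ω ∂P =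
    ((t : ℝ) ^ (2 * H) + (s : ℝ) ^ (2 * H) - |(t : ℝ) - (s : ℝ)| ^ (2 * H)) / 2
  continuous_paths : ∀ᵐ ω ∂P, Continuous fun t => Z t ω

/-- The time change `a_t = H e^{α t / H} / α` of Doob's transform, a point of `[0, ∞)`. -/
noncomputable def doobTime (H α t : ℝ) : ℝ≥0 :=
  Real.toNNReal (H * Real.exp (α * t / H) / α)

/-- The path of `Y^{(α)}`: `Y_t = ∫_0^t e^{-α s} dZ_{a_s}` for `t ∈ ℝ`, with `a_s = a_s(α, H)`. -/
noncomputable def drivingProcess {Ω : Type*} (H α : ℝ) (Z : ℝ≥0 → Ω → ℝ) (t : ℝ) (ω : Ω) : ℝ :=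
  rsIntegral (fun s => Real.exp (-α * s)) (fun s => Z (doobTime H α s) ω) 0 t

/-- The fractional Ornstein-Uhlenbeck process of the second kind,
`U_t = e^{-γ t} ∫_{-∞}^t e^{γ s} dY_s` for `t ∈ ℝ`, with `Y = Y^{(1)}`. -/
noncomputable def fractionalOU {Ω : Type*} (H γ : ℝ) (Z : ℝ≥0 → Ω → ℝ) (t : ℝ) (ω : Ω) : ℝ :=
  Real.exp (-γ * t) *
    rsIntegralIic (fun s => Real.exp (γ * s)) (fun s => drivingProcess H 1 Z s ω) t

/-- On the interval `J`, the continuous function `u` solves the Langevin equation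
`du = -γ u dt + dy`, in integrated form. -/
structure IsLangevinSolutionOn (γ : ℝ) (y u : ℝ → ℝ) (J : Set ℝ) : Prop where
  ordConnected : J.OrdConnected
  continuousOn : ContinuousOn u J
  equation : ∀ s ∈ J, ∀ t ∈ J, u t - u s = -γ * (∫ r in s..t, u r) + (y t - y s)

/-- `f` is locally Hölder continuous of order `β` on `J`: it is Hölder continuous of order `β` on
every compact interval contained in `J`. -/
def LocallyHolderOn (β : ℝ≥0) (f : ℝ → ℝ) (J : Set ℝ) : Prop :=
  ∀ a b : ℝ, Icc a b ⊆ J → ∃ C : ℝ≥0, HolderOnWith C β f (Icc a b)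

/-! ### Riemann-Stieltjes integrals -/

/-! All integrands are smooth and all integrators continuous, so integration by parts
(`hasRSIntegral_of_hasDerivAt`) turns each Riemann-Stieltjes integral into boundary terms minus an
ordinary integral. With G_s = Z_{a_s}, both Y and U therefore have the form φG + ψ with φ, ψ of
class C¹, and they inherit the Hölder order of G (`LocallyHolderOn.mul_add`), which is that of Z
because the time change is smooth.

The only probabilistic input is `ae_isRegularPath`: almost every path of Z is continuous, starts at
0 and is locally Hölder of every order below H. This is Kolmogorov's criterion applied to E|Z_t -
Z_s|^p = c_p |t - s|^{Hp} with p large.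

For the integrals from -∞, Hölder continuity at time 0 gives G_s = O(e^{αβs/H}) as s → -∞ for every
β < H. Since γ > 0, a β close to H makes G_s e^{(γ-α)s} decay exponentially. In the Langevin
equation the drift is Lipschitz on compact intervals, so the solution is as regular as the noise. -/

theorem IsTaggedPartition.mem_uIcc {a b δ : ℝ} {n : ℕ} {x ξ : ℕ → ℝ}
    (h : IsTaggedPartition a b δ n x ξ) {i : ℕ} (hi : i ≤ n) : x i ∈ uIcc a b := by
  rw [← h.left, ← h.right]
  rcases h.monotone_or_antitone with hm | hm
  · have key : ∀ j k, j ≤ k → k ≤ n → x j ≤ x k := by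
      intro j k hjk
      induction k, hjk using Nat.le_induction with
      | base => intro _; exact le_rfl
      | succ k _ ih => intro hk; exact (ih (by omega)).trans (hm k (by omega))
    exact mem_uIcc_of_le (key 0 i (Nat.zero_le _) hi) (key i n hi le_rfl)
  · have key : ∀ j k, j ≤ k → k ≤ n → x k ≤ x j := by
      intro j k hjk
      induction k, hjk using Nat.le_induction with
      | base => intro _; exact le_rfl
      | succ k _ ih => intro hk; exact (hm k (by omega)).trans (ih (by omega))
    exact mem_uIcc_of_ge (key i n hi le_rfl) (key 0 i (Nat.zero_le _) hi)

theorem IsTaggedPartition.sum_abs_sub {a b δ : ℝ} {n : ℕ} {x ξ : ℕ → ℝ}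
    (h : IsTaggedPartition a b δ n x ξ) :
    ∑ i ∈ Finset.range n, |x (i + 1) - x i| = |b - a| := by
  have htel : ∑ i ∈ Finset.range n, (x (i + 1) - x i) = b - a := by
    rw [Finset.sum_range_sub, h.left, h.right]
  rcases h.monotone_or_antitone with hm | hm
  · have h1 : ∑ i ∈ Finset.range n, |x (i + 1) - x i| = b - a := by
      rw [← htel]
      exact Finset.sum_congr rfl fun i hi =>
        abs_of_nonneg (sub_nonneg.2 (hm i (Finset.mem_range.1 hi)))
    have h2 : 0 ≤ b - a := h1 ▸ Finset.sum_nonneg fun _ _ => abs_nonneg _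
    rw [h1, abs_of_nonneg h2]
  · have h1 : ∑ i ∈ Finset.range n, |x (i + 1) - x i| = -(b - a) := by
      rw [← htel, ← Finset.sum_neg_distrib]
      exact Finset.sum_congr rfl fun i hi =>
        abs_of_nonpos (sub_nonpos.2 (hm i (Finset.mem_range.1 hi)))
    have h2 : 0 ≤ -(b - a) := h1 ▸ Finset.sum_nonneg fun _ _ => abs_nonneg _
    rw [h1, abs_of_nonpos (by linarith)]

/-- Equal steps suffice. Without fine partitions `HasRSIntegral` would hold vacuously; uniqueness of
the integral rests on this. -/
theorem exists_isTaggedPartition (a b : ℝ) {δ : ℝ} (hδ : 0 < δ) :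
    ∃ (n : ℕ) (x ξ : ℕ → ℝ), IsTaggedPartition a b δ n x ξ := by
  obtain ⟨n, hn⟩ := exists_nat_gt (|b - a| / δ)
  have hn0 : (0 : ℝ) < n := lt_of_le_of_lt (by positivity) hn
  have hstep : ∀ i : ℕ, (a + (b - a) * ((i + 1 : ℕ) : ℝ) / n) - (a + (b - a) * (i : ℝ) / n)
      = (b - a) / n := by
    intro i; push_cast; field_simp; ring
  refine ⟨n, fun i => a + (b - a) * i / n, fun i => a + (b - a) * i / n, ?_, ?_, ?_, ?_, ?_⟩
  · simp
  · field_simp; ring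
  · rcases le_total a b with h | h
    · refine Or.inl fun i _ => ?_
      have := div_nonneg (sub_nonneg.2 h) hn0.le
      linarith [hstep i]
    · refine Or.inr fun i _ => ?_
      have := div_nonpos_of_nonpos_of_nonneg (sub_nonpos.2 h) hn0.le
      linarith [hstep i]
  · intro i _
    rw [hstep, abs_div, abs_of_pos hn0, div_lt_iff₀ hn0]
    rwa [div_lt_iff₀ hδ, mul_comm] at hn
  · intro i _
    exact left_mem_uIcc

theorem IsTaggedPartition.mono {a b δ δ' : ℝ} {n : ℕ} {x ξ : ℕ → ℝ}
    (h : IsTaggedPartition a b δ n x ξ) (hδ : δ ≤ δ') : IsTaggedPartition a b δ' n x ξ :=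
  ⟨h.left, h.right, h.monotone_or_antitone, fun i hi => (h.mesh i hi).trans_le hδ, h.tag⟩

theorem HasRSIntegral.unique {f g : ℝ → ℝ} {a b I J : ℝ} (hI : HasRSIntegral f g a b I)
    (hJ : HasRSIntegral f g a b J) : I = J := by
  refine eq_of_forall_dist_le fun ε hε => ?_
  obtain ⟨δ₁, hδ₁, h₁⟩ := hI (ε / 2) (half_pos hε)
  obtain ⟨δ₂, hδ₂, h₂⟩ := hJ (ε / 2) (half_pos hε)
  obtain ⟨n, x, ξ, hx⟩ := exists_isTaggedPartition a b (lt_min hδ₁ hδ₂)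
  have e₁ := h₁ n x ξ (hx.mono (min_le_left _ _))
  have e₂ := h₂ n x ξ (hx.mono (min_le_right _ _))
  rw [Real.dist_eq]
  rw [abs_lt] at e₁ e₂
  rw [abs_le]
  constructor <;> linarith

theorem HasRSIntegral.rsIntegral_eq {f g : ℝ → ℝ} {a b I : ℝ} (h : HasRSIntegral f g a b I) :
    rsIntegral f g a b = I := by
  have hex : ∃ I, HasRSIntegral f g a b I := ⟨I, h⟩
  rw [rsIntegral, dif_pos hex]
  exact hex.choose_spec.unique h

theorem HasRSIntegralIic.rsIntegralIic_eq {f g : ℝ → ℝ} {b I : ℝ}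
    (h : HasRSIntegralIic f g b I) : rsIntegralIic f g b = I := by
  have hex : ∃ I, HasRSIntegralIic f g b I := ⟨I, h⟩
  rw [rsIntegralIic, dif_pos hex]
  exact tendsto_nhds_unique hex.choose_spec.2 h.2

/-- Integration by parts: a continuously differentiable function is Riemann-Stieltjes integrable
against a continuous one. -/
theorem hasRSIntegral_of_hasDerivAt {f f' g : ℝ → ℝ} (hf : ∀ x, HasDerivAt f (f' x) x)
    (hf' : Continuous f') (hg : Continuous g) (a b : ℝ) :
    HasRSIntegral f g a b (f b * g b - f a * g a - ∫ s in a..b, g s * f' s) := by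
  intro ε hε
  obtain ⟨M, hM⟩ := isCompact_uIcc.exists_bound_of_continuousOn (s := uIcc a b) hf'.continuousOn
  have hM0 : 0 ≤ M := (norm_nonneg _).trans (hM a left_mem_uIcc)
  -- The added 1 covers M * |b - a| = 0 and makes the final inequality strict.
  have hη : 0 < ε / (M * |b - a| + 1) := by positivity
  obtain ⟨δ, hδ, hgδ⟩ := Metric.uniformContinuousOn_iff.1
    (isCompact_uIcc.uniformContinuousOn_of_continuous (s := uIcc a b) hg.continuousOn) _ hη
  set η := ε / (M * |b - a| + 1) with hη_def
  refine ⟨δ, hδ, fun n x ξ hx => ?_⟩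
  have hint : ∀ (c u v : ℝ), IntervalIntegrable (fun s => (g s - c) * f' s) volume u v :=
    fun c u v => ((hg.sub continuous_const).mul hf').intervalIntegrable _ _
  have hint' : ∀ u v : ℝ, IntervalIntegrable (fun s => g s * f' s) volume u v :=
    fun u v => (hg.mul hf').intervalIntegrable _ _
  have hsub : ∀ c u v : ℝ, ∫ s in u..v, (g s - c) * f' s
      = (∫ s in u..v, g s * f' s) - c * (f v - f u) := by
    intro c u v
    rw [← intervalIntegral.integral_eq_sub_of_hasDerivAt (fun x _ => hf x)
      (hf'.intervalIntegrable _ _), ← intervalIntegral.integral_const_mul]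
    simp only [sub_mul]
    exact intervalIntegral.integral_sub (hint' u v)
      ((continuous_const.mul hf').intervalIntegrable _ _)
  -- Integrating by parts on each side of the tag, with g centred at the adjacent partition point,
  -- leaves an error controlled by the oscillation of g on the piece.
  have hterm : ∀ i ∈ Finset.range n,
      f (ξ i) * (g (x (i + 1)) - g (x i)) - ((f (x (i + 1)) * g (x (i + 1)) - f (x i) * g (x i))
        - ∫ s in x i..x (i + 1), g s * f' s)
      = (∫ s in x i..ξ i, (g s - g (x i)) * f' s)
        + ∫ s in ξ i..x (i + 1), (g s - g (x (i + 1))) * f' s := by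
    intro i _
    rw [hsub, hsub, ← intervalIntegral.integral_add_adjacent_intervals (hint' (x i) (ξ i))
      (hint' (ξ i) (x (i + 1)))]
    ring
  have htot : f b * g b - f a * g a - ∫ s in a..b, g s * f' s
      = ∑ i ∈ Finset.range n, ((f (x (i + 1)) * g (x (i + 1)) - f (x i) * g (x i))
        - ∫ s in x i..x (i + 1), g s * f' s) := by
    rw [Finset.sum_sub_distrib, Finset.sum_range_sub (fun i => f (x i) * g (x i)),
      intervalIntegral.sum_integral_adjacent_intervals (fun k _ => hint' _ _), hx.left, hx.right]
  rw [htot, ← Finset.sum_sub_distrib, Finset.sum_congr rfl hterm]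
  have hpiece : ∀ i < n, ∀ c u v : ℝ, c ∈ uIcc (x i) (x (i + 1)) → u ∈ uIcc (x i) (x (i + 1)) →
      v ∈ uIcc (x i) (x (i + 1)) →
      |∫ s in u..v, (g s - g c) * f' s| ≤ η * M * |v - u| := by
    intro i hi c u v hc hu hv
    have hsubset : uIcc (x i) (x (i + 1)) ⊆ uIcc a b :=
      uIcc_subset_uIcc (hx.mem_uIcc hi.le) (hx.mem_uIcc hi)
    rw [← Real.norm_eq_abs]
    refine intervalIntegral.norm_integral_le_of_norm_le_const fun s hs => ?_
    have hs' : s ∈ uIcc (x i) (x (i + 1)) := uIcc_subset_uIcc hu hv (uIoc_subset_uIcc hs)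
    rw [norm_mul]
    refine mul_le_mul ?_ (hM s (hsubset hs')) (norm_nonneg _) hη.le
    have hd : dist s c < δ := by
      rw [Real.dist_eq]
      exact (abs_sub_le_of_uIcc_subset_uIcc (uIcc_subset_uIcc hc hs')).trans_lt (hx.mesh i hi)
    exact (hgδ s (hsubset hs') c (hsubset hc) hd).le
  calc |∑ i ∈ Finset.range n, ((∫ s in x i..ξ i, (g s - g (x i)) * f' s)
        + ∫ s in ξ i..x (i + 1), (g s - g (x (i + 1))) * f' s)|
      ≤ ∑ i ∈ Finset.range n, η * M * |x (i + 1) - x i| := by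
        refine (Finset.abs_sum_le_sum_abs _ _).trans (Finset.sum_le_sum fun i hi => ?_)
        have hi := Finset.mem_range.1 hi
        have hξ := hx.tag i hi
        have e1 := hpiece i hi (x i) (x i) (ξ i) left_mem_uIcc left_mem_uIcc hξ
        have e2 := hpiece i hi (x (i + 1)) (ξ i) (x (i + 1)) right_mem_uIcc hξ right_mem_uIcc
        have e3 : |ξ i - x i| + |x (i + 1) - ξ i| = |x (i + 1) - x i| := by
          rcases mem_uIcc.1 hξ with ⟨h1, h2⟩ | ⟨h1, h2⟩
          · rw [abs_of_nonneg, abs_of_nonneg, abs_of_nonneg] <;> linarith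
          · rw [abs_of_nonpos, abs_of_nonpos, abs_of_nonpos] <;> linarith
        rw [← e3, mul_add]
        exact (abs_add_le _ _).trans (add_le_add e1 e2)
    _ = η * (M * |b - a|) := by rw [← Finset.mul_sum, hx.sum_abs_sub, mul_assoc]
    _ < η * (M * |b - a| + 1) := by gcongr; linarith
    _ = ε := by rw [hη_def]; field_simp

/-! ### Hölder continuity -/

theorem locallyHolderOn_of_forall_exists {β : ℝ≥0} {f : ℝ → ℝ} {J : Set ℝ}
    (h : ∀ a b : ℝ, Icc a b ⊆ J → ∃ C : ℝ, ∀ x ∈ Icc a b, ∀ y ∈ Icc a b,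
      |f x - f y| ≤ C * |x - y| ^ (β : ℝ)) : LocallyHolderOn β f J := by
  intro a b hab
  obtain ⟨C, hC⟩ := h a b hab
  refine ⟨C.toNNReal, fun x hx y hy => ?_⟩
  rw [edist_dist, edist_dist, Real.dist_eq, Real.dist_eq,
    ENNReal.ofReal_rpow_of_nonneg (abs_nonneg _) β.coe_nonneg, ENNReal.ofNNReal_toNNReal,
    ← ENNReal.ofReal_mul' (by positivity)]
  exact ENNReal.ofReal_le_ofReal (hC x hx y hy)

theorem LocallyHolderOn.exists_abs_sub_le {β : ℝ≥0} {f : ℝ → ℝ} {J : Set ℝ}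
    (h : LocallyHolderOn β f J) {a b : ℝ} (hab : Icc a b ⊆ J) :
    ∃ C : ℝ, 0 ≤ C ∧ ∀ x ∈ Icc a b, ∀ y ∈ Icc a b, |f x - f y| ≤ C * |x - y| ^ (β : ℝ) := by
  obtain ⟨C, hC⟩ := h a b hab
  exact ⟨C, C.2, fun x hx y hy => by simpa [Real.dist_eq] using hC.dist_le hx hy⟩

/-- On a bounded interval a larger Hölder exponent is the stronger condition. -/
theorem abs_sub_rpow_le_mul_rpow {a b x y β r : ℝ} (hβ : β ≤ r) (hr : 0 < r) (hx : x ∈ Icc a b)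
    (hy : y ∈ Icc a b) : |x - y| ^ r ≤ (b - a) ^ (r - β) * |x - y| ^ β := by
  rcases (abs_nonneg (x - y)).eq_or_lt with h | h
  · rw [← h, Real.zero_rpow hr.ne']
    exact mul_nonneg (Real.rpow_nonneg (by linarith [hx.1, hx.2]) _) (Real.rpow_nonneg le_rfl _)
  · have hle : |x - y| ≤ b - a := abs_sub_le_iff.2
      ⟨by linarith [hx.2, hy.1], by linarith [hy.2, hx.1]⟩
    calc |x - y| ^ r = |x - y| ^ (r - β) * |x - y| ^ β := by
          rw [← Real.rpow_add h]; simp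
      _ ≤ (b - a) ^ (r - β) * |x - y| ^ β := by
          gcongr

theorem abs_sub_le_mul_rpow {a b x y β : ℝ} (hβ : β ≤ 1) (hx : x ∈ Icc a b) (hy : y ∈ Icc a b) :
    |x - y| ≤ (b - a) ^ (1 - β) * |x - y| ^ β := by
  simpa using abs_sub_rpow_le_mul_rpow hβ one_pos hx hy

theorem ContDiff.exists_abs_sub_le {φ : ℝ → ℝ} (hφ : ContDiff ℝ 1 φ) (a b : ℝ) :
    ∃ C : ℝ, 0 ≤ C ∧ ∀ x ∈ Icc a b, ∀ y ∈ Icc a b, |φ x - φ y| ≤ C * |x - y| := by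
  obtain ⟨C, hC⟩ := isCompact_Icc.exists_bound_of_continuousOn (s := Icc a b)
    (hφ.continuous_deriv le_rfl).continuousOn
  refine ⟨max C 0, le_max_right _ _, fun x hx y hy => ?_⟩
  refine (convex_Icc a b).norm_image_sub_le_of_norm_deriv_le
    (fun z _ => hφ.differentiable one_ne_zero z) (fun z hz => (hC z hz).trans (le_max_left _ _)) hy hx

/-- On compact intervals C¹ functions are Lipschitz, hence Hölder of order β ≤ 1, and all factors
are bounded. Used with G the time-changed path. -/
theorem LocallyHolderOn.mul_add {β : ℝ≥0} (hβ : β ≤ 1) {φ ψ G : ℝ → ℝ} (hφ : ContDiff ℝ 1 φ)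
    (hψ : ContDiff ℝ 1 ψ) (hGc : Continuous G) (hG : LocallyHolderOn β G univ) :
    LocallyHolderOn β (fun t => φ t * G t + ψ t) univ := by
  refine locallyHolderOn_of_forall_exists fun a b _ => ?_
  obtain ⟨C₁, hC₁, h₁⟩ := hφ.exists_abs_sub_le a b
  obtain ⟨C₂, hC₂, h₂⟩ := hψ.exists_abs_sub_le a b
  obtain ⟨C₃, hC₃, h₃⟩ := hG.exists_abs_sub_le (subset_univ (Icc a b))
  obtain ⟨A, hA⟩ := isCompact_Icc.exists_bound_of_continuousOn (s := Icc a b)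
    hφ.continuous.continuousOn
  obtain ⟨B, hB⟩ := isCompact_Icc.exists_bound_of_continuousOn (s := Icc a b) hGc.continuousOn
  refine ⟨A * C₃ + (B * C₁ + C₂) * (b - a) ^ (1 - (β : ℝ)), fun x hx y hy => ?_⟩
  have hd := abs_sub_le_mul_rpow (β := β) (by exact_mod_cast hβ) hx hy
  have hB0 : 0 ≤ B := (norm_nonneg _).trans (hB x hx)
  have hA0 : 0 ≤ A := (norm_nonneg _).trans (hA x hx)
  calc |φ x * G x + ψ x - (φ y * G y + ψ y)|
      = |φ x * (G x - G y) + G y * (φ x - φ y) + (ψ x - ψ y)| := by ring_nf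
    _ ≤ |φ x| * |G x - G y| + |G y| * |φ x - φ y| + |ψ x - ψ y| := by
        rw [← abs_mul, ← abs_mul]
        exact (abs_add_le _ _).trans (add_le_add_left (abs_add_le _ _) _)
    _ ≤ A * (C₃ * |x - y| ^ (β : ℝ)) + B * (C₁ * |x - y|) + C₂ * |x - y| := by
        gcongr
        · exact hA x hx
        · exact h₃ x hx y hy
        · exact hB y hy
        · exact h₁ x hx y hy
        · exact h₂ x hx y hy
    _ = A * C₃ * |x - y| ^ (β : ℝ) + (B * C₁ + C₂) * |x - y| := by ring
    _ ≤ A * C₃ * |x - y| ^ (β : ℝ)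
          + (B * C₁ + C₂) * ((b - a) ^ (1 - (β : ℝ)) * |x - y| ^ (β : ℝ)) := by gcongr
    _ = _ := by ring

theorem contDiff_one_integral {h : ℝ → ℝ} (hh : Continuous h) (a : ℝ) :
    ContDiff ℝ 1 fun t => ∫ s in a..t, h s := by
  have hd : ∀ t, HasDerivAt (fun t => ∫ s in a..t, h s) (h t) t := fun t =>
    intervalIntegral.integral_hasDerivAt_right (hh.intervalIntegrable _ _)
      hh.aestronglyMeasurable.stronglyMeasurableAtFilter hh.continuousAt
  rw [contDiff_one_iff_deriv]
  exact ⟨fun t => (hd t).differentiableAt, by rwa [funext fun t => (hd t).deriv]⟩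

/-- A continuous u is bounded on a compact interval, so its drift integral is Lipschitz there; no
explicit solution formula is needed. -/
theorem IsLangevinSolutionOn.locallyHolderOn {γ : ℝ} {y u : ℝ → ℝ} {J : Set ℝ}
    (hu : IsLangevinSolutionOn γ y u J) {β : ℝ≥0} (hβ : β ≤ 1) (hy : LocallyHolderOn β y univ) :
    LocallyHolderOn β u J := by
  refine locallyHolderOn_of_forall_exists fun a b hab => ?_
  obtain ⟨B, hB⟩ := isCompact_Icc.exists_bound_of_continuousOn (s := Icc a b)
    (hu.continuousOn.mono hab)
  obtain ⟨C, hC, hyC⟩ := hy.exists_abs_sub_le (subset_univ (Icc a b))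
  refine ⟨|γ| * (B * (b - a) ^ (1 - (β : ℝ))) + C, fun s hs t ht => ?_⟩
  have hB0 : 0 ≤ B := (norm_nonneg _).trans (hB s hs)
  have hint : |∫ r in t..s, u r| ≤ B * |s - t| :=
    intervalIntegral.norm_integral_le_of_norm_le_const fun r hr =>
      hB r (by
        have := uIoc_subset_uIcc hr
        exact ordConnected_Icc.uIcc_subset ht hs this)
  have hd := abs_sub_le_mul_rpow (β := β) (by exact_mod_cast hβ) hs ht
  rw [hu.equation t (hab ht) s (hab hs)]
  calc |-γ * (∫ r in t..s, u r) + (y s - y t)|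
      ≤ |γ| * |∫ r in t..s, u r| + |y s - y t| := by
        refine (abs_add_le _ _).trans_eq ?_
        rw [abs_mul, abs_neg]
    _ ≤ |γ| * (B * ((b - a) ^ (1 - (β : ℝ)) * |s - t| ^ (β : ℝ))) + C * |s - t| ^ (β : ℝ) := by
        gcongr
        · exact hint.trans (by gcongr)
        · exact hyC s hs t ht
    _ = _ := by ring

/-- A continuous function on `[0, 1]` whose dyadic increments decay geometrically is Hölder. -/
theorem exists_holder_of_dyadic {f : ℝ → ℝ} (hf : ContinuousOn f (Icc 0 1)) {C β : ℝ}
    (hC : 0 ≤ C) (hβ : 0 < β)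
    (h : ∀ n k : ℕ, k < 2 ^ n →
      |f ((k + 1 : ℕ) / 2 ^ n) - f (k / 2 ^ n)| ≤ C * ((1 / 2 : ℝ) ^ β) ^ n) :
    ∃ D : ℝ, ∀ s ∈ Icc (0 : ℝ) 1, ∀ t ∈ Icc (0 : ℝ) 1, |f t - f s| ≤ D * |t - s| ^ β := by
  set q : ℝ := (1 / 2 : ℝ) ^ β with hq
  have hq0 : 0 < q := by positivity
  have hq1 : q < 1 := Real.rpow_lt_one (by norm_num) (by norm_num) hβ
  -- For t ≥ 0 this is the largest dyadic point of level n not exceeding t.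
  set d : ℕ → ℝ → ℝ := fun n t => (⌊(2 : ℝ) ^ n * t⌋₊ : ℝ) / 2 ^ n with hd
  have hd_le : ∀ n t, 0 ≤ t → d n t ≤ t := by
    intro n t ht
    rw [hd]; dsimp only
    rw [div_le_iff₀ (by positivity), mul_comm t]
    exact Nat.floor_le (by positivity)
  have hd_mem : ∀ n, ∀ t ∈ Icc (0 : ℝ) 1, d n t ∈ Icc (0 : ℝ) 1 := fun n t ht =>
    ⟨by positivity, (hd_le n t ht.1).trans ht.2⟩
  have hd_tendsto : ∀ t ∈ Icc (0 : ℝ) 1, Tendsto (fun n => d n t) atTop (𝓝 t) := by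
    intro t ht
    have h1 : Tendsto (fun n : ℕ => t - (1 / 2 : ℝ) ^ n) atTop (𝓝 t) := by
      simpa using (tendsto_pow_atTop_nhds_zero_of_lt_one (r := (1 / 2 : ℝ)) (by norm_num)
        (by norm_num)).const_sub t
    refine tendsto_of_tendsto_of_tendsto_of_le_of_le h1 tendsto_const_nhds (fun n => ?_)
      (fun n => hd_le n t ht.1)
    have := Nat.lt_floor_add_one ((2 : ℝ) ^ n * t)
    have hp : (0 : ℝ) < 2 ^ n := by positivity
    simp only [hd]
    rw [le_div_iff₀ hp, sub_mul, ← mul_pow]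
    norm_num
    linarith
  have hstep : ∀ t ∈ Icc (0 : ℝ) 1, ∀ n, dist (f (d n t)) (f (d (n + 1) t)) ≤ C * q ^ n := by
    intro t ht n
    -- Successive approximations thus coincide (m even) or are neighbours at level n + 1 (m odd), so
    -- the chain d n t → t costs a geometric series.
    have hfl : ⌊(2 : ℝ) ^ n * t⌋₊ = ⌊(2 : ℝ) ^ (n + 1) * t⌋₊ / 2 := by
      rw [← Nat.floor_div_natCast, pow_succ]
      congr 1; push_cast; ring
    set m := ⌊(2 : ℝ) ^ (n + 1) * t⌋₊ with hm
    have hm_le : m ≤ 2 ^ (n + 1) := by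
      have : (m : ℝ) ≤ 2 ^ (n + 1) :=
        (Nat.floor_le (by have := ht.1; positivity)).trans
          (mul_le_of_le_one_right (by positivity) ht.2)
      exact_mod_cast this
    have hdn : d n t = ((2 * (m / 2) : ℕ) : ℝ) / 2 ^ (n + 1) := by
      simp only [hd, hfl]; push_cast; rw [pow_succ]; field_simp
    have hdn' : d (n + 1) t = (m : ℝ) / 2 ^ (n + 1) := rfl
    rcases Nat.even_or_odd' m with ⟨j, hj | hj⟩
    · have : 2 * (m / 2) = m := by omega
      rw [hdn, hdn', this, dist_self]; positivity
    · have h1 : 2 * (m / 2) = 2 * j := by omega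
      rw [hdn, hdn', h1, hj, dist_comm, Real.dist_eq]
      refine (h (n + 1) (2 * j) (by omega)).trans ?_
      rw [pow_succ]
      have : q ^ n * q ≤ q ^ n := mul_le_of_le_one_right (by positivity) hq1.le
      gcongr
  have happrox : ∀ t ∈ Icc (0 : ℝ) 1, ∀ n, dist (f (d n t)) (f t) ≤ C * q ^ n / (1 - q) := by
    intro t ht n
    refine dist_le_of_le_geometric_of_tendsto q C hq1 (hstep t ht) ?_ n
    exact (hf t ht).tendsto.comp (tendsto_nhdsWithin_iff.2
      ⟨hd_tendsto t ht, Eventually.of_forall fun n => hd_mem n t ht⟩)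
  have hlt : ∀ s ∈ Icc (0 : ℝ) 1, ∀ t ∈ Icc (0 : ℝ) 1, s < t →
      |f t - f s| ≤ (2 * C / (1 - q) + C) / q * |t - s| ^ β := by
    intro s hs t ht hst
    -- The level satisfies 2^{-(n+1)} < t - s ≤ 2^{-n}: the upper bound puts the level-n
    -- approximations at most one step apart, the lower one gives q^(n+1) ≤ |t - s|^β, whence the
    -- division by q.
    obtain ⟨n, hn1, hn2⟩ := exists_nat_pow_near_of_lt_one (sub_pos.2 hst)
      (by linarith [hs.1, ht.2]) (by norm_num : (0 : ℝ) < 1 / 2) (by norm_num)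
    have hp : (0 : ℝ) < 2 ^ n := by positivity
    have hmul : (2 : ℝ) ^ n * t ≤ 2 ^ n * s + 1 := by
      have : (2 : ℝ) ^ n * (t - s) ≤ 2 ^ n * (1 / 2) ^ n := by gcongr
      rw [← mul_pow] at this
      norm_num at this
      linarith
    have hmid : dist (f (d n s)) (f (d n t)) ≤ C * q ^ n := by
      have l1 : ⌊(2 : ℝ) ^ n * s⌋₊ ≤ ⌊(2 : ℝ) ^ n * t⌋₊ := Nat.floor_mono (by gcongr)
      have l2 : ⌊(2 : ℝ) ^ n * t⌋₊ ≤ ⌊(2 : ℝ) ^ n * s⌋₊ + 1 := by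
        rw [← Nat.floor_add_one (by have := hs.1; positivity)]
        exact Nat.floor_mono hmul
      have l3 : ⌊(2 : ℝ) ^ n * t⌋₊ ≤ 2 ^ n := by
        have : (⌊(2 : ℝ) ^ n * t⌋₊ : ℝ) ≤ 2 ^ n :=
          (Nat.floor_le (by have := ht.1; positivity)).trans
            (mul_le_of_le_one_right (by positivity) ht.2)
        exact_mod_cast this
      simp only [hd]
      rcases Nat.lt_or_ge ⌊(2 : ℝ) ^ n * s⌋₊ ⌊(2 : ℝ) ^ n * t⌋₊ with l | l
      · have e : ⌊(2 : ℝ) ^ n * t⌋₊ = ⌊(2 : ℝ) ^ n * s⌋₊ + 1 := by omega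
        rw [e, dist_comm, Real.dist_eq]
        exact h n _ (by omega)
      · rw [le_antisymm l l1, dist_self]; positivity
    have hqn : q ^ n ≤ |t - s| ^ β / q := by
      rw [le_div_iff₀ hq0, ← pow_succ, abs_of_pos (sub_pos.2 hst), hq, ← Real.rpow_natCast,
        ← Real.rpow_mul (by norm_num), mul_comm, Real.rpow_mul (by norm_num), Real.rpow_natCast]
      exact Real.rpow_le_rpow (by positivity) hn1.le hβ.le
    have h1q : 0 < 1 - q := by linarith
    calc |f t - f s| = dist (f s) (f t) := by rw [dist_comm, Real.dist_eq]
      _ ≤ dist (f s) (f (d n s)) + dist (f (d n s)) (f (d n t)) + dist (f (d n t)) (f t) :=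
          dist_triangle4 _ _ _ _
      _ ≤ C * q ^ n / (1 - q) + C * q ^ n + C * q ^ n / (1 - q) := by
          gcongr
          · rw [dist_comm]; exact happrox s hs n
          · exact happrox t ht n
      _ = (2 * C / (1 - q) + C) * q ^ n := by ring
      _ ≤ (2 * C / (1 - q) + C) * (|t - s| ^ β / q) := by gcongr
      _ = _ := by ring
  refine ⟨(2 * C / (1 - q) + C) / q, fun s hs t ht => ?_⟩
  rcases lt_trichotomy s t with hst | rfl | hst
  · exact hlt s hs t ht hst
  · simp [Real.zero_rpow hβ.ne']
  · rw [abs_sub_comm, abs_sub_comm t]; exact hlt t ht s hs hst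

/-! ### Kolmogorov's continuity criterion -/

/-- Kolmogorov's criterion for a process whose paths are already known to be continuous. -/
theorem ae_exists_holder_of_lintegral_pow_le {Ω : Type*} [MeasurableSpace Ω] {P : Measure Ω}
    {X : ℝ → Ω → ℝ} (hX : ∀ t, AEMeasurable (X t) P)
    (hcont : ∀ᵐ ω ∂P, ContinuousOn (fun t => X t ω) (Icc 0 1)) {p : ℕ} (hp : p ≠ 0) {M : ENNReal}
    (hM : M ≠ ⊤) {r β : ℝ} (hβ : 0 < β) (hr : 1 + β * p < r)
    (h : ∀ s ∈ Icc (0 : ℝ) 1, ∀ t ∈ Icc (0 : ℝ) 1,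
      ∫⁻ ω, ‖X t ω - X s ω‖ₑ ^ p ∂P ≤ M * ENNReal.ofReal (|t - s| ^ r)) :
    ∀ᵐ ω ∂P, ∃ D : ℝ, ∀ s ∈ Icc (0 : ℝ) 1, ∀ t ∈ Icc (0 : ℝ) 1,
      |X t ω - X s ω| ≤ D * |t - s| ^ β := by
  set q : ℝ := (1 / 2 : ℝ) ^ β with hq
  have hq0 : 0 < q := by positivity
  -- The p-th powers of dyadic increments, normalised by q^n. Their total sum has finite
  -- expectation, so it is almost surely finite and bounds every term; this replaces a
  -- Borel-Cantelli argument.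
  set F : ℕ → ℕ → Ω → ENNReal := fun n k ω =>
    (‖X ((k + 1 : ℕ) / 2 ^ n) ω - X (k / 2 ^ n) ω‖ₑ * ENNReal.ofReal ((q⁻¹) ^ n)) ^ p with hF
  have hFm : ∀ n k, AEMeasurable (F n k) P := fun n k =>
    ((((hX _).sub (hX _)).enorm).mul_const _).pow_const _
  -- Ratio of the geometric series over levels: 2^n increments at level n, hence ρ = 2^{1+βp-r},
  -- below 1 exactly by `hr`.
  set ρ : ℝ := 2 * ((q⁻¹) ^ p * (1 / 2 : ℝ) ^ r) with hρ
  have hρ1 : ρ < 1 := by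
    have e : ρ = (1 / 2 : ℝ) ^ (r - (1 + β * p)) := by
      rw [hρ, hq, ← Real.inv_rpow (by norm_num), ← Real.rpow_natCast, ← Real.rpow_mul (by norm_num),
        Real.rpow_sub (by norm_num), Real.rpow_add (by norm_num), Real.rpow_one,
        Real.inv_rpow (by norm_num)]
      field_simp
    rw [e]
    exact Real.rpow_lt_one (by norm_num) (by norm_num) (by linarith)
  have hFint : ∀ n k, k < 2 ^ n →
      ∫⁻ ω, F n k ω ∂P ≤ M * ENNReal.ofReal (((q⁻¹) ^ p * (1 / 2 : ℝ) ^ r) ^ n) := by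
    intro n k hk
    have hk' : ((k : ℝ) + 1) ≤ 2 ^ n := by exact_mod_cast hk
    have hp2 : (0 : ℝ) < 2 ^ n := by positivity
    simp only [hF, mul_pow]
    rw [lintegral_mul_const' _ _ (by simp)]
    have h1 := h (k / 2 ^ n) ⟨by positivity, (div_le_one hp2).2 (by linarith)⟩
      ((k + 1 : ℕ) / 2 ^ n) ⟨by positivity, (div_le_one hp2).2 (by push_cast; exact hk')⟩
    have e : |((k + 1 : ℕ) : ℝ) / 2 ^ n - k / 2 ^ n| = (1 / 2 : ℝ) ^ n := by
      rw [← sub_div]; push_cast; rw [add_sub_cancel_left, abs_of_pos (by positivity), div_pow,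
        one_pow]
    have e' : ((1 / 2 : ℝ) ^ n) ^ r = ((1 / 2 : ℝ) ^ r) ^ n := by
      rw [← Real.rpow_natCast, ← Real.rpow_natCast, ← Real.rpow_mul (by norm_num),
        ← Real.rpow_mul (by norm_num), mul_comm]
    rw [e, e'] at h1
    calc _ ≤ M * ENNReal.ofReal (((1 / 2 : ℝ) ^ r) ^ n) * ENNReal.ofReal ((q⁻¹) ^ n) ^ p := by
          gcongr
      _ = _ := by
          rw [mul_assoc, ← ENNReal.ofReal_pow (by positivity), ← ENNReal.ofReal_mul (by positivity),
            mul_comm (_ ^ n), pow_right_comm, ← mul_pow]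
  have hsum : ∫⁻ ω, ∑' n, ∑ k ∈ Finset.range (2 ^ n), F n k ω ∂P ≠ ⊤ := by
    rw [lintegral_tsum fun n => Finset.aemeasurable_fun_sum _ fun k _ => hFm n k]
    have hle : ∀ n, ∫⁻ ω, ∑ k ∈ Finset.range (2 ^ n), F n k ω ∂P ≤ M * ENNReal.ofReal ρ ^ n := by
      intro n
      rw [lintegral_finsetSum' _ fun k _ => hFm n k]
      refine (Finset.sum_le_card_nsmul _ _ _
        fun k hk => hFint n k (Finset.mem_range.1 hk)).trans_eq ?_
      rw [Finset.card_range, nsmul_eq_mul, hρ, ENNReal.ofReal_mul (by norm_num),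
        ENNReal.ofReal_pow (by positivity), mul_pow, ENNReal.ofReal_ofNat]
      push_cast
      ring
    refine ne_top_of_le_ne_top ?_ (ENNReal.tsum_le_tsum hle)
    rw [ENNReal.tsum_mul_left, ENNReal.tsum_geometric]
    refine ENNReal.mul_ne_top hM (ENNReal.inv_ne_top.2 (tsub_pos_of_lt ?_).ne')
    exact ENNReal.ofReal_lt_one.2 hρ1
  have hfin := ae_lt_top' (AEMeasurable.tsum fun n =>
    Finset.aemeasurable_fun_sum _ fun k _ => hFm n k) hsum
  filter_upwards [hcont, hfin] with ω hω hS
  set S := ∑' n, ∑ k ∈ Finset.range (2 ^ n), F n k ω with hS_def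
  refine exists_holder_of_dyadic (C := 1 + S.toReal) hω (by positivity) hβ fun n k hk => ?_
  have hle : F n k ω ≤ S :=
    (Finset.single_le_sum (f := fun k => F n k ω) (fun _ _ => zero_le) (Finset.mem_range.2 hk)).trans
      (ENNReal.le_tsum (f := fun n => ∑ k ∈ Finset.range (2 ^ n), F n k ω) n)
  have hle' := ENNReal.toReal_mono hS.ne hle
  simp only [hF, ENNReal.toReal_pow, ENNReal.toReal_mul, toReal_enorm, Real.norm_eq_abs] at hle'
  rw [ENNReal.toReal_ofReal (by positivity)] at hle'
  set y := |X ((k + 1 : ℕ) / 2 ^ n) ω - X (k / 2 ^ n) ω| with hy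
  have hy0 : 0 ≤ y * (q⁻¹) ^ n := by positivity
  -- A number w ≥ 0 with w^p ≤ S is at most 1 or at most w^p, so no root of S is needed.
  have hb : y * (q⁻¹) ^ n ≤ 1 + S.toReal := by
    rcases le_total (y * (q⁻¹) ^ n) 1 with h1 | h1
    · linarith [ENNReal.toReal_nonneg (a := S)]
    · linarith [le_self_pow₀ h1 hp]
  rwa [inv_pow, ← div_eq_mul_inv, div_le_iff₀ (by positivity)] at hb

/-- A centred Gaussian of variance v is √v times a standard one. -/
theorem lintegral_enorm_pow_gaussianReal (v : ℝ≥0) (p : ℕ) :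
    ∫⁻ x, ‖x‖ₑ ^ p ∂(gaussianReal 0 v)
      = (∫⁻ x, ‖x‖ₑ ^ p ∂(gaussianReal 0 1)) * ENNReal.ofReal (Real.sqrt v ^ p) := by
  have e : gaussianReal 0 v = (gaussianReal 0 1).map (Real.sqrt v * ·) := by
    rw [gaussianReal_map_const_mul]
    congr 1
    · simp
    · ext; simp [Real.sq_sqrt v.coe_nonneg]
  rw [e, lintegral_map (by fun_prop) (by fun_prop)]
  simp only [enorm_mul, mul_pow]
  rw [lintegral_const_mul' _ _ (by simp), mul_comm, Real.enorm_of_nonneg (Real.sqrt_nonneg _),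
    ENNReal.ofReal_pow (Real.sqrt_nonneg _)]

theorem lintegral_enorm_pow_gaussianReal_ne_top (v : ℝ≥0) {p : ℕ} (hp : p ≠ 0) :
    ∫⁻ x, ‖x‖ₑ ^ p ∂(gaussianReal 0 v) ≠ ⊤ := by
  have h := lintegral_rpow_enorm_lt_top_of_eLpNorm_lt_top (p := (p : ENNReal)) (by simpa using hp)
    (by simp) (memLp_id_gaussianReal' (μ := 0) (v := v) (p : ENNReal) (by simp)).2
  simpa using h.ne

/-! ### Fractional Brownian motion -/

/-- A continuous path that starts at `0` and is locally Hölder of every order less than `H`. -/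
structure IsRegularPath (H : ℝ) (z : ℝ≥0 → ℝ) : Prop where
  zero : z 0 = 0
  continuous : Continuous z
  holder : ∀ β : ℝ, 0 < β → β < H → ∀ N : ℝ, ∃ D : ℝ, 0 ≤ D ∧ ∀ s t : ℝ≥0,
    (s : ℝ) ≤ N → (t : ℝ) ≤ N → |z t - z s| ≤ D * |(t : ℝ) - s| ^ β

namespace IsFractionalBrownianMotion

variable {Ω : Type*} [MeasurableSpace Ω] {P : Measure Ω} {H : ℝ} {Z : ℝ≥0 → Ω → ℝ}

/-- The increment is Gaussian and centred; expanding its square, the powers of t and s in the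
covariances cancel. -/
theorem map_sub_eq_gaussianReal (hZ : IsFractionalBrownianMotion H Z P) (hH : 0 < H) (s t : ℝ≥0) :
    P.map (fun ω => Z t ω - Z s ω)
      = gaussianReal 0 (|(t : ℝ) - s| ^ (2 * H)).toNNReal := by
  have hP : IsProbabilityMeasure P := hZ.gaussian.isProbabilityMeasure
  have hL2 : ∀ t, MemLp (Z t) 2 P := fun t => (hZ.gaussian.hasGaussianLaw_eval t).memLp_two
  have hmul : ∀ s t, Integrable (fun ω => Z t ω * Z s ω) P := fun s t =>
    (hL2 t).integrable_mul (hL2 s)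
  have hlaw : HasGaussianLaw (fun ω => Z t ω - Z s ω) P := hZ.gaussian.hasGaussianLaw_fun_sub
  have hmean : ∫ ω, (Z t ω - Z s ω) ∂P = 0 := by
    rw [integral_sub ((hL2 t).integrable one_le_two) ((hL2 s).integrable one_le_two),
      hZ.centered, hZ.centered, sub_zero]
  rw [hlaw.map_eq_gaussianReal, hmean,
    variance_of_integral_eq_zero hlaw.aemeasurable hmean]
  congr 2
  have e : ∀ ω, (Z t ω - Z s ω) ^ 2 = Z t ω * Z t ω - 2 * (Z t ω * Z s ω) + Z s ω * Z s ω :=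
    fun ω => by ring
  have h0 : (0 : ℝ) ^ (2 * H) = 0 := Real.zero_rpow (by positivity)
  simp only [e]
  have hint : Integrable (fun ω => Z t ω * Z t ω - 2 * (Z t ω * Z s ω)) P :=
    (hmul t t).sub ((hmul s t).const_mul 2)
  rw [integral_add hint (hmul s s),
    integral_sub (hmul t t) ((hmul s t).const_mul 2), integral_const_mul, hZ.covariance,
    hZ.covariance, hZ.covariance]
  simp only [sub_self, abs_zero, h0]
  ring

theorem ae_zero_eq_zero (hZ : IsFractionalBrownianMotion H Z P) (hH : 0 < H) :
    ∀ᵐ ω ∂P, Z 0 ω = 0 := by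
  have hP : IsProbabilityMeasure P := hZ.gaussian.isProbabilityMeasure
  have hL2 : MemLp (Z 0) 2 P := (hZ.gaussian.hasGaussianLaw_eval 0).memLp_two
  have h0 : (0 : ℝ) ^ (2 * H) = 0 := Real.zero_rpow (by positivity)
  have h := hZ.covariance 0 0
  simp only [NNReal.coe_zero, sub_self, abs_zero, h0, add_zero, zero_div] at h
  rw [integral_eq_zero_iff_of_nonneg (fun ω => mul_self_nonneg _) (hL2.integrable_mul hL2)] at h
  filter_upwards [h] with ω hω
  simpa using hω

theorem lintegral_enorm_sub_pow (hZ : IsFractionalBrownianMotion H Z P) (hH : 0 < H) (s t : ℝ≥0)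
    (p : ℕ) : ∫⁻ ω, ‖Z t ω - Z s ω‖ₑ ^ p ∂P
      = (∫⁻ x, ‖x‖ₑ ^ p ∂(gaussianReal 0 1)) * ENNReal.ofReal (|(t : ℝ) - s| ^ (H * p)) := by
  have hm : AEMeasurable (fun ω => Z t ω - Z s ω) P :=
    (hZ.gaussian.aemeasurable t).sub (hZ.gaussian.aemeasurable s)
  rw [← lintegral_map' (f := fun x : ℝ => ‖x‖ₑ ^ p) (by fun_prop) hm,
    hZ.map_sub_eq_gaussianReal hH, lintegral_enorm_pow_gaussianReal,
    Real.coe_toNNReal _ (by positivity), Real.sqrt_eq_rpow, ← Real.rpow_mul (abs_nonneg _),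
    ← Real.rpow_natCast, ← Real.rpow_mul (abs_nonneg _)]
  congr 4
  ring

theorem ae_exists_holder (hZ : IsFractionalBrownianMotion H Z P) (hH : 0 < H) {β : ℝ}
    (hβ : 0 < β) (hβH : β < H) {N : ℝ} (hN : 0 < N) :
    ∀ᵐ ω ∂P, ∃ D : ℝ, ∀ s t : ℝ≥0, (s : ℝ) ≤ N → (t : ℝ) ≤ N →
      |Z t ω - Z s ω| ≤ D * |(t : ℝ) - s| ^ β := by
  -- This makes (H - β)p > 1, so the moment exponent Hp exceeds 1 + βp, as Kolmogorov's criterion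
  -- requires.
  obtain ⟨p, hp⟩ := exists_nat_gt (1 / (H - β))
  have hHβ : 0 < H - β := sub_pos.2 hβH
  have hp0 : p ≠ 0 := by
    rintro rfl
    have : 0 < 1 / (H - β) := by positivity
    simp only [Nat.cast_zero] at hp
    linarith
  have hr : 1 + β * p < H * p := by
    rw [div_lt_iff₀ hHβ] at hp; linarith
  have key := ae_exists_holder_of_lintegral_pow_le (P := P)
    (X := fun x ω => Z (Real.toNNReal (N * x)) ω) (p := p)
    (M := (∫⁻ x, ‖x‖ₑ ^ p ∂(gaussianReal 0 1)) * ENNReal.ofReal (N ^ (H * p)))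
    (fun t => hZ.gaussian.aemeasurable _)
    (by
      filter_upwards [hZ.continuous_paths] with ω hω
      exact (hω.comp (continuous_real_toNNReal.comp (continuous_const.mul continuous_id))).continuousOn)
    hp0 (ENNReal.mul_ne_top (lintegral_enorm_pow_gaussianReal_ne_top 1 hp0) ENNReal.ofReal_ne_top)
    hβ hr
    (by
      intro s hs t ht
      rw [hZ.lintegral_enorm_sub_pow hH, Real.coe_toNNReal _ (mul_nonneg hN.le ht.1),
        Real.coe_toNNReal _ (mul_nonneg hN.le hs.1), ← mul_sub, abs_mul, abs_of_pos hN,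
        Real.mul_rpow hN.le (abs_nonneg _), ENNReal.ofReal_mul (by positivity), mul_assoc])
  filter_upwards [key] with ω ⟨D, hD⟩
  refine ⟨D * N⁻¹ ^ β, fun s t hs ht => ?_⟩
  have h := hD (s / N) ⟨by positivity, (div_le_one hN).2 hs⟩ (t / N)
    ⟨by positivity, (div_le_one hN).2 ht⟩
  simp only [mul_div_cancel₀ _ hN.ne', Real.toNNReal_coe] at h
  rw [← sub_div, abs_div, abs_of_pos hN, div_eq_inv_mul, Real.mul_rpow (by positivity)
    (abs_nonneg _), ← mul_assoc] at h
  exact h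

theorem ae_isRegularPath (hZ : IsFractionalBrownianMotion H Z P) (hH : 0 < H) :
    ∀ᵐ ω ∂P, IsRegularPath H fun t => Z t ω := by
  -- Countably many exponents and time horizons give one null set; a general β is reached through a
  -- rational in (β, H). The bound N + 1 keeps the horizon positive.
  have hq : ∀ᵐ ω ∂P, ∀ q : ℚ, 0 < (q : ℝ) ∧ (q : ℝ) < H → ∀ N : ℕ, ∃ D : ℝ, ∀ s t : ℝ≥0,
      (s : ℝ) ≤ N + 1 → (t : ℝ) ≤ N + 1 → |Z t ω - Z s ω| ≤ D * |(t : ℝ) - s| ^ (q : ℝ) := by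
    refine ae_all_iff.2 fun q => ?_
    by_cases h : 0 < (q : ℝ) ∧ (q : ℝ) < H
    · have := ae_all_iff.2 fun N : ℕ =>
        hZ.ae_exists_holder hH h.1 h.2 (N := N + 1) (by positivity)
      filter_upwards [this] with ω hω _
      exact hω
    · exact Eventually.of_forall fun ω h' => absurd h' h
  filter_upwards [hZ.ae_zero_eq_zero hH, hZ.continuous_paths, hq] with ω h0 hc hω
  refine ⟨h0, hc, fun β hβ hβH N => ?_⟩
  obtain ⟨q, hβq, hqH⟩ := exists_rat_btwn hβH
  obtain ⟨n, hn⟩ := exists_nat_ge N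
  obtain ⟨D, hD⟩ := hω q ⟨hβ.trans hβq, hqH⟩ n
  refine ⟨|D| * ((n : ℝ) + 1) ^ ((q : ℝ) - β), by positivity, fun s t hs ht => ?_⟩
  have hs' : (s : ℝ) ≤ n + 1 := by linarith
  have ht' : (t : ℝ) ≤ n + 1 := by linarith
  have h1 := abs_sub_rpow_le_mul_rpow hβq.le (hβ.trans hβq) (a := 0) ⟨t.coe_nonneg, ht'⟩
    ⟨s.coe_nonneg, hs'⟩
  rw [sub_zero] at h1
  calc |Z t ω - Z s ω| ≤ D * |(t : ℝ) - s| ^ (q : ℝ) := hD s t hs' ht'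
    _ ≤ |D| * |(t : ℝ) - s| ^ (q : ℝ) := by gcongr; exact le_abs_self D
    _ ≤ |D| * (((n : ℝ) + 1) ^ ((q : ℝ) - β) * |(t : ℝ) - s| ^ β) := by gcongr
    _ = _ := by ring

end IsFractionalBrownianMotion

/-! ### Doob's transform and the Langevin equation, path by path -/

theorem coe_doobTime {H α : ℝ} (hH : 0 < H) (hα : 0 < α) (t : ℝ) :
    (doobTime H α t : ℝ) = H * Real.exp (α * t / H) / α :=
  Real.coe_toNNReal _ (by positivity)

theorem continuous_doobTime (H α : ℝ) : Continuous (doobTime H α) := by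
  unfold doobTime; fun_prop

theorem coe_doobTime_le {H α : ℝ} (hH : 0 < H) (hα : 0 < α) {s t : ℝ} (hst : s ≤ t) :
    (doobTime H α s : ℝ) ≤ doobTime H α t := by
  rw [coe_doobTime hH hα, coe_doobTime hH hα]
  gcongr

theorem hasDerivAt_exp_mul (c x : ℝ) :
    HasDerivAt (fun s => Real.exp (c * s)) (c * Real.exp (c * x)) x := by
  simpa [mul_comm] using ((hasDerivAt_id x).const_mul c).exp

theorem hasRSIntegral_exp_mul {g : ℝ → ℝ} (hg : Continuous g) (c a b : ℝ) :
    HasRSIntegral (fun s => Real.exp (c * s)) g a b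
      (Real.exp (c * b) * g b - Real.exp (c * a) * g a
        - c * ∫ s in a..b, g s * Real.exp (c * s)) := by
  have h := hasRSIntegral_of_hasDerivAt (hasDerivAt_exp_mul c) (by fun_prop) hg a b
  have e : ∫ s in a..b, g s * (c * Real.exp (c * s)) = c * ∫ s in a..b, g s * Real.exp (c * s) := by
    rw [← intervalIntegral.integral_const_mul]
    congr 1; ext s; ring
  rwa [e] at h

namespace IsRegularPath

variable {H : ℝ} {z : ℝ≥0 → ℝ}

theorem continuous_comp_doobTime (hz : IsRegularPath H z) (α : ℝ) :
    Continuous fun s => z (doobTime H α s) :=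
  hz.continuous.comp (continuous_doobTime H α)

theorem locallyHolderOn_comp_doobTime (hz : IsRegularPath H z) (hH : 0 < H) {α : ℝ} (hα : 0 < α)
    {β : ℝ≥0} (hβ : 0 < β) (hβH : (β : ℝ) < H) :
    LocallyHolderOn β (fun s => z (doobTime H α s)) univ := by
  refine locallyHolderOn_of_forall_exists fun a b _ => ?_
  obtain ⟨D, hD, hzD⟩ := hz.holder β (by exact_mod_cast hβ) hβH (doobTime H α b)
  have hsmooth : ContDiff ℝ 1 fun t => H * Real.exp (α * t / H) / α := by fun_prop
  obtain ⟨C, hC, hC'⟩ := hsmooth.exists_abs_sub_le a b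
  refine ⟨D * C ^ (β : ℝ), fun x hx y hy => ?_⟩
  have h1 := hzD _ _ (coe_doobTime_le hH hα hy.2) (coe_doobTime_le hH hα hx.2)
  rw [coe_doobTime hH hα, coe_doobTime hH hα] at h1
  calc _ ≤ _ := h1
    _ ≤ D * (C * |x - y|) ^ (β : ℝ) := by gcongr; exact hC' x hx y hy
    _ = _ := by rw [Real.mul_rpow hC (abs_nonneg _), mul_assoc]

/-- Since z 0 = 0, the Hölder bound against time 0 gives |z(a_s)| ≤ D a_s^β, and a_s is exponential
in s. -/
theorem exists_abs_comp_doobTime_le (hz : IsRegularPath H z) (hH : 0 < H) {α : ℝ} (hα : 0 < α)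
    {β : ℝ} (hβ : 0 < β) (hβH : β < H) (t : ℝ) :
    ∃ C : ℝ, ∀ s ≤ t, |z (doobTime H α s)| ≤ C * Real.exp (α * β / H * s) := by
  obtain ⟨D, hD, hzD⟩ := hz.holder β hβ hβH (doobTime H α t)
  refine ⟨D * (H / α) ^ β, fun s hs => ?_⟩
  have h1 := hzD 0 (doobTime H α s) (by simp) (coe_doobTime_le hH hα hs)
  rw [hz.zero, sub_zero, NNReal.coe_zero, sub_zero, abs_of_nonneg (NNReal.coe_nonneg _),
    coe_doobTime hH hα, mul_div_right_comm, Real.mul_rpow (by positivity) (by positivity),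
    ← Real.exp_mul, ← mul_assoc] at h1
  convert h1 using 3
  ring

/-- The path of `Y^{(α)}` driven by `z`, after an integration by parts. -/
theorem hasRSIntegral_driving (hz : IsRegularPath H z) (α t : ℝ) :
    HasRSIntegral (fun s => Real.exp (-α * s)) (fun s => z (doobTime H α s)) 0 t
      (Real.exp (-α * t) * z (doobTime H α t) - z (doobTime H α 0)
        + α * ∫ s in 0..t, z (doobTime H α s) * Real.exp (-α * s)) := by
  convert hasRSIntegral_exp_mul (hz.continuous_comp_doobTime α) (-α) 0 t using 1
  simp

theorem rsIntegral_driving_eq (hz : IsRegularPath H z) (α t : ℝ) :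
    rsIntegral (fun s => Real.exp (-α * s)) (fun s => z (doobTime H α s)) 0 t
      = Real.exp (-α * t) * z (doobTime H α t) + (α * (∫ s in 0..t, z (doobTime H α s)
        * Real.exp (-α * s)) - z (doobTime H α 0)) := by
  rw [(hz.hasRSIntegral_driving α t).rsIntegral_eq]; ring

theorem contDiff_integral_comp_doobTime (hz : IsRegularPath H z) (α c : ℝ) :
    ContDiff ℝ 1 fun t => ∫ s in 0..t, z (doobTime H α s) * Real.exp (c * s) :=
  contDiff_one_integral ((hz.continuous_comp_doobTime α).mul (by fun_prop)) 0

theorem continuous_driving (hz : IsRegularPath H z) (α : ℝ) :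
    Continuous fun t => rsIntegral (fun s => Real.exp (-α * s))
      (fun s => z (doobTime H α s)) 0 t := by
  simp only [hz.rsIntegral_driving_eq]
  have h1 := (hz.contDiff_integral_comp_doobTime α (-α)).continuous
  exact (Continuous.mul (by fun_prop) (hz.continuous_comp_doobTime α)).add
    ((h1.const_mul α).sub continuous_const)

theorem locallyHolderOn_driving (hz : IsRegularPath H z) (hH : 0 < H) (hH1 : H < 1) {α : ℝ}
    (hα : 0 < α) {β : ℝ≥0} (hβ : 0 < β) (hβH : (β : ℝ) < H) :
    LocallyHolderOn β (fun t => rsIntegral (fun s => Real.exp (-α * s))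
      (fun s => z (doobTime H α s)) 0 t) univ := by
  simp only [hz.rsIntegral_driving_eq]
  have h1 := hz.contDiff_integral_comp_doobTime α (-α)
  exact LocallyHolderOn.mul_add (φ := fun t => Real.exp (-α * t))
    (by exact_mod_cast (hβH.trans hH1).le) (by fun_prop)
    ((contDiff_const.mul h1).sub contDiff_const)
    (hz.continuous_comp_doobTime α) (hz.locallyHolderOn_comp_doobTime hH hα hβ hβH)

/-- Substitution: integrating `e^{γ s}` against `Y` is integrating `e^{(γ - α) s}` against the
time-changed path. -/
theorem hasRSIntegral_exp_driving (hz : IsRegularPath H z) (α γ a b : ℝ) :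
    HasRSIntegral (fun s => Real.exp (γ * s)) (fun t => rsIntegral (fun s => Real.exp (-α * s))
      (fun s => z (doobTime H α s)) 0 t) a b
      (Real.exp ((γ - α) * b) * z (doobTime H α b) - Real.exp ((γ - α) * a) * z (doobTime H α a)
        - (γ - α) * ∫ s in a..b, z (doobTime H α s) * Real.exp ((γ - α) * s)) := by
  have h := hasRSIntegral_exp_mul (hz.continuous_driving α) γ a b
  simp only [hz.rsIntegral_driving_eq] at h ⊢
  set G : ℝ → ℝ := fun s => z (doobTime H α s) with hG
  have hGc : Continuous G := hz.continuous_comp_doobTime α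
  -- The C¹ part of Y, which is e^{-αt} G + K.
  set K : ℝ → ℝ := fun t => α * (∫ s in 0..t, G s * Real.exp (-α * s)) - G 0 with hK
  have hKd : ∀ t, HasDerivAt K (α * (G t * Real.exp (-α * t))) t := fun t => by
    have hc : Continuous fun s => G s * Real.exp (-α * s) := by fun_prop
    exact ((intervalIntegral.integral_hasDerivAt_right (hc.intervalIntegrable _ _)
      hc.aestronglyMeasurable.stronglyMeasurableAtFilter hc.continuousAt).const_mul α).sub_const _
  have hKc : Continuous K := continuous_iff_continuousAt.2 fun t => (hKd t).continuousAt
  have hexp : ∀ s, Real.exp (γ * s) * Real.exp (-α * s) = Real.exp ((γ - α) * s) := fun s => by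
    rw [← Real.exp_add]; ring_nf
  -- Integrating K by parts cancels its boundary terms and changes the factor γ in front of ∫ G
  -- e^{(γ-α)s} into γ - α.
  have hibp : (∫ s in a..b, K s * (γ * Real.exp (γ * s)))
      + (∫ s in a..b, α * (G s * Real.exp (-α * s)) * Real.exp (γ * s))
      = K b * Real.exp (γ * b) - K a * Real.exp (γ * a) := by
    rw [intervalIntegral.integral_mul_deriv_eq_deriv_mul (fun x _ => hKd x)
      (fun x _ => hasDerivAt_exp_mul γ x) (Continuous.intervalIntegrable (by fun_prop) _ _)
      (Continuous.intervalIntegrable (by fun_prop) _ _)]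
    ring
  have e1 : ∫ s in a..b, K s * (γ * Real.exp (γ * s)) = γ * ∫ s in a..b, K s * Real.exp (γ * s) := by
    rw [← intervalIntegral.integral_const_mul]
    congr 1; ext s; ring
  have e2 : ∫ s in a..b, α * (G s * Real.exp (-α * s)) * Real.exp (γ * s)
      = α * ∫ s in a..b, G s * Real.exp ((γ - α) * s) := by
    rw [← intervalIntegral.integral_const_mul]
    congr 1; ext s; rw [← hexp]; ring
  have e3 : ∫ s in a..b, (Real.exp (-α * s) * G s + K s) * Real.exp (γ * s)
      = (∫ s in a..b, G s * Real.exp ((γ - α) * s)) + ∫ s in a..b, K s * Real.exp (γ * s) := by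
    rw [← intervalIntegral.integral_add (Continuous.intervalIntegrable (by fun_prop) _ _)
      (Continuous.intervalIntegrable (by fun_prop) _ _)]
    congr 1; ext s; rw [← hexp]; ring
  rw [e1, e2] at hibp
  change HasRSIntegral _ (fun t => Real.exp (-α * t) * G t + K t) a b
    (Real.exp (γ * b) * (Real.exp (-α * b) * G b + K b)
      - Real.exp (γ * a) * (Real.exp (-α * a) * G a + K a)
      - γ * ∫ s in a..b, (Real.exp (-α * s) * G s + K s) * Real.exp (γ * s)) at h
  rw [e3] at h
  change HasRSIntegral _ (fun t => Real.exp (-α * t) * G t + K t) a b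
    (Real.exp ((γ - α) * b) * G b - Real.exp ((γ - α) * a) * G a
      - (γ - α) * ∫ s in a..b, G s * Real.exp ((γ - α) * s))
  convert h using 1
  rw [← hexp, ← hexp]
  linear_combination hibp

/-! ### Decay at -∞ and the improper integrals -/

theorem exists_exponent {γ α : ℝ} (hH : 0 < H) (hα : 0 < α) (hγ : 0 < γ) :
    ∃ β : ℝ, 0 < β ∧ β < H ∧ 0 < α * β / H + (γ - α) := by
  -- The decay rate αβ/H + γ - α vanishes at β = H(1 - γ/α) and tends to γ > 0 as β ↑ H; the maximum
  -- with 0 keeps β positive.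
  obtain ⟨β, h1, h2⟩ := exists_between (max_lt hH (show H * (1 - γ / α) < H by
    have : 0 < H * (γ / α) := by positivity
    linarith))
  refine ⟨β, (le_max_left _ _).trans_lt h1, h2, ?_⟩
  have h3 : H * (1 - γ / α) < β := (le_max_right _ _).trans_lt h1
  have h4 : α * (H * (1 - γ / α)) / H < α * β / H := by gcongr
  have h5 : α * (H * (1 - γ / α)) / H = α - γ := by field_simp
  linarith

theorem exists_abs_mul_exp_le (hz : IsRegularPath H z) (hH : 0 < H) {α γ : ℝ} (hα : 0 < α)
    (hγ : 0 < γ) : ∃ κ : ℝ, 0 < κ ∧ ∀ t : ℝ, ∃ C : ℝ, ∀ s ≤ t,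
      |z (doobTime H α s) * Real.exp ((γ - α) * s)| ≤ C * Real.exp (κ * s) := by
  obtain ⟨β, hβ, hβH, hκ⟩ := exists_exponent (γ := γ) hH hα hγ
  refine ⟨_, hκ, fun t => ?_⟩
  obtain ⟨C, hC⟩ := hz.exists_abs_comp_doobTime_le hH hα hβ hβH t
  refine ⟨C, fun s hs => ?_⟩
  rw [abs_mul, Real.abs_exp, add_mul, Real.exp_add, ← mul_assoc]
  exact mul_le_mul_of_nonneg_right (hC s hs) (Real.exp_nonneg _)

theorem integrableOn_Iic (hz : IsRegularPath H z) (hH : 0 < H) {α γ : ℝ} (hα : 0 < α)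
    (hγ : 0 < γ) (t : ℝ) :
    IntegrableOn (fun s => z (doobTime H α s) * Real.exp ((γ - α) * s)) (Iic t) := by
  obtain ⟨κ, hκ, h⟩ := hz.exists_abs_mul_exp_le hH hα hγ
  obtain ⟨C, hC⟩ := h t
  refine ((integrableOn_exp_mul_Iic hκ t).const_mul C).mono'
    ((hz.continuous_comp_doobTime α).mul (by fun_prop)).aestronglyMeasurable ?_
  exact (ae_restrict_mem measurableSet_Iic).mono fun s hs => hC s hs

theorem tendsto_atBot (hz : IsRegularPath H z) (hH : 0 < H) {α γ : ℝ} (hα : 0 < α)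
    (hγ : 0 < γ) :
    Tendsto (fun s => z (doobTime H α s) * Real.exp ((γ - α) * s)) atBot (𝓝 0) := by
  obtain ⟨κ, hκ, h⟩ := hz.exists_abs_mul_exp_le hH hα hγ
  obtain ⟨C, hC⟩ := h 0
  refine squeeze_zero_norm' ((eventually_le_atBot 0).mono hC) ?_
  have : Tendsto (fun s : ℝ => Real.exp (κ * s)) atBot (𝓝 0) :=
    Real.tendsto_exp_atBot.comp (tendsto_id.const_mul_atBot hκ)
  simpa using this.const_mul C

/-- As T → -∞ the boundary term at T vanishes and the ordinary integral converges. Leaving f and g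
free lets both expressions for U share this limit, so they coincide. -/
theorem hasRSIntegralIic_of_forall (hz : IsRegularPath H z) (hH : 0 < H) {α γ : ℝ} (hα : 0 < α)
    (hγ : 0 < γ) {f g : ℝ → ℝ} {t : ℝ}
    (h : ∀ T, HasRSIntegral f g T t (Real.exp ((γ - α) * t) * z (doobTime H α t)
      - Real.exp ((γ - α) * T) * z (doobTime H α T)
      - (γ - α) * ∫ s in T..t, z (doobTime H α s) * Real.exp ((γ - α) * s))) :
    HasRSIntegralIic f g t (Real.exp ((γ - α) * t) * z (doobTime H α t)
      - (γ - α) * ∫ s in Iic t, z (doobTime H α s) * Real.exp ((γ - α) * s)) := by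
  refine ⟨fun T _ => ⟨_, h T⟩, ?_⟩
  simp only [fun T => (h T).rsIntegral_eq]
  have h1 := intervalIntegral_tendsto_integral_Iic t (hz.integrableOn_Iic hH hα hγ t)
    (tendsto_id (α := ℝ) (x := atBot))
  have h2 := hz.tendsto_atBot hH hα hγ
  simp only [mul_comm (z _)] at h1 h2 ⊢
  simpa using (h2.const_sub (Real.exp ((γ - α) * t) * z (doobTime H α t))).sub
    (h1.const_mul (γ - α))

theorem hasRSIntegralIic_driving (hz : IsRegularPath H z) (hH : 0 < H) {α γ : ℝ} (hα : 0 < α)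
    (hγ : 0 < γ) (t : ℝ) :
    HasRSIntegralIic (fun s => Real.exp (γ * s)) (fun t => rsIntegral (fun s => Real.exp (-α * s))
      (fun s => z (doobTime H α s)) 0 t) t (Real.exp ((γ - α) * t) * z (doobTime H α t)
      - (γ - α) * ∫ s in Iic t, z (doobTime H α s) * Real.exp ((γ - α) * s)) :=
  hz.hasRSIntegralIic_of_forall hH hα hγ fun T => hz.hasRSIntegral_exp_driving α γ T t

theorem hasRSIntegralIic_comp_doobTime (hz : IsRegularPath H z) (hH : 0 < H) {α γ : ℝ}
    (hα : 0 < α) (hγ : 0 < γ) (t : ℝ) :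
    HasRSIntegralIic (fun s => Real.exp ((γ - α) * s)) (fun s => z (doobTime H α s)) t
      (Real.exp ((γ - α) * t) * z (doobTime H α t)
      - (γ - α) * ∫ s in Iic t, z (doobTime H α s) * Real.exp ((γ - α) * s)) :=
  hz.hasRSIntegralIic_of_forall hH hα hγ fun T =>
    hasRSIntegral_exp_mul (hz.continuous_comp_doobTime α) (γ - α) T t

theorem locallyHolderOn_ornsteinUhlenbeck (hz : IsRegularPath H z) (hH : 0 < H) (hH1 : H < 1)
    {α γ : ℝ} (hα : 0 < α) (hγ : 0 < γ) {β : ℝ≥0} (hβ : 0 < β) (hβH : (β : ℝ) < H) :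
    LocallyHolderOn β (fun t => Real.exp (-γ * t) * rsIntegralIic (fun s => Real.exp (γ * s))
      (fun t => rsIntegral (fun s => Real.exp (-α * s)) (fun s => z (doobTime H α s)) 0 t) t)
      univ := by
  -- Splitting the improper integral at 0 confines the dependence on t to a C¹ integral over [0, t].
  set c : ℝ := ∫ s in Iic (0 : ℝ), z (doobTime H α s) * Real.exp ((γ - α) * s) with hc
  have e : ∀ t, Real.exp (-γ * t) * rsIntegralIic (fun s => Real.exp (γ * s))
      (fun t => rsIntegral (fun s => Real.exp (-α * s)) (fun s => z (doobTime H α s)) 0 t) t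
      = Real.exp (-α * t) * z (doobTime H α t) + -(γ - α) * (Real.exp (-γ * t) *
        (c + ∫ s in 0..t, z (doobTime H α s) * Real.exp ((γ - α) * s))) := by
    intro t
    rw [(hz.hasRSIntegralIic_driving hH hα hγ t).rsIntegralIic_eq,
      ← intervalIntegral.integral_Iic_sub_Iic (hz.integrableOn_Iic hH hα hγ 0)
      (hz.integrableOn_Iic hH hα hγ t)]
    have : Real.exp (-α * t) = Real.exp (-γ * t) * Real.exp ((γ - α) * t) := by
      rw [← Real.exp_add]; ring_nf
    rw [this]; ring
  simp only [e]
  have h1 := hz.contDiff_integral_comp_doobTime α (γ - α)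
  exact LocallyHolderOn.mul_add (φ := fun t => Real.exp (-α * t))
    (by exact_mod_cast (hβH.trans hH1).le) (by fun_prop)
    (contDiff_const.mul (ContDiff.mul (by fun_prop) (contDiff_const.add h1)))
    (hz.continuous_comp_doobTime α) (hz.locallyHolderOn_comp_doobTime hH hα hβ hβH)

end IsRegularPath

theorem mainTheorem8 {Ω : Type*} [MeasurableSpace Ω] (P : Measure Ω) [IsProbabilityMeasure P]
    (H : ℝ) (hH0 : 0 < H) (hH1 : H < 1) (Z : ℝ≥0 → Ω → ℝ)
    (hZ : IsFractionalBrownianMotion H Z P) (α γ : ℝ) (hα : 0 < α) (hγ : 0 < γ) :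
    (∀ᵐ ω ∂P,
      (∀ t : ℝ, ∃ I : ℝ, HasRSIntegral (fun s => Real.exp (-α * s))
        (fun s => Z (doobTime H α s) ω) 0 t I) ∧
      ∀ β : ℝ≥0, 0 < β → (β : ℝ) < H →
        LocallyHolderOn β (fun t => drivingProcess H α Z t ω) univ) ∧
    (∀ᵐ ω ∂P,
      (∀ t : ℝ, ∃ I : ℝ,
        HasRSIntegralIic (fun s => Real.exp (γ * s)) (fun s => drivingProcess H 1 Z s ω) t I ∧
        HasRSIntegralIic (fun s => Real.exp ((γ - 1) * s)) (fun s => Z (doobTime H 1 s) ω) t I) ∧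
      ∀ β : ℝ≥0, 0 < β → (β : ℝ) < H →
        LocallyHolderOn β (fun t => fractionalOU H γ Z t ω) univ) ∧
    (∀ᵐ ω ∂P, ∀ (J : Set ℝ) (u : ℝ → ℝ),
      IsLangevinSolutionOn γ (fun t => drivingProcess H 1 Z t ω) u J →
      ∀ β : ℝ≥0, 0 < β → (β : ℝ) < H → LocallyHolderOn β u J) := by
  have hreg := hZ.ae_isRegularPath hH0
  -- All three claims hold on the event of regular paths; the last two use the pathwise results at α
  -- = 1.
  refine ⟨?_, ?_, ?_⟩
  · filter_upwards [hreg] with ω hz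
    exact ⟨fun t => ⟨_, hz.hasRSIntegral_driving α t⟩,
      fun β hβ hβH => hz.locallyHolderOn_driving hH0 hH1 hα hβ hβH⟩
  · filter_upwards [hreg] with ω hz
    exact ⟨fun t => ⟨_, hz.hasRSIntegralIic_driving hH0 one_pos hγ t,
      hz.hasRSIntegralIic_comp_doobTime hH0 one_pos hγ t⟩,
      fun β hβ hβH => hz.locallyHolderOn_ornsteinUhlenbeck hH0 hH1 one_pos hγ hβ hβH⟩
  · filter_upwards [hreg] with ω hz J u hu β hβ hβH
    exact hu.locallyHolderOn (by exact_mod_cast (hβH.trans hH1).le)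
      (hz.locallyHolderOn_driving hH0 hH1 one_pos hβ hβH)
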